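/- Let $\mathcal A$ be a von Neumann algebra on a complex Hilbert space, and let $G$ be a group acting on $\mathcal A$ by normal $*$-automorphisms. (A linear functional on, or a $*$-automorphism of, $\mathcal A$ is normal if it is $\sigma$-weakly continuous.) A state $\varphi$ on $\mathcal A$ is called $G$-invariant if $\varphi(g(a))=\varphi(a)$ for all $g\in G$, $a\in\mathcal A$. It is called $G$-quasi-invariant if it is faithful and normal and for every $g\in G$ there is $x_g\in\mathcal A$ with $$\varphi(g(a))=\varphi(x_g a)\qquad (a\in\mathcal A).$$ The family $(x_g)_{g\in G}$, which is then unique, is called the cocycle of $\varphi$. Consider the condition $$\text{(A)}\qquad \text{there is } \lambda>0 \text{ such that } \|x_g\|\le\lambda \text{ for all } g\in G.$$ 1. If $\varphi$ is a $G$-quasi-invariant state on $\mathcal A$ whose cocycle satisfies (A), then there exist a faithful normal $G$-invariant state $\psi$ on $\mathcal A$ and an element $d\in\mathcal A$ such that $\psi(a)=\varphi(da)$ for all $a\in\mathcal A$. 2. Conversely, let $\varphi$ be a state on $\mathcal A$ and suppose that there exist a faithful normal $G$-invariant state $\psi$ on $\mathcal A$ and an invertible element $d\in\mathcal A$ such that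 $\psi(a)=\varphi(da)$ for all $a\in\mathcal A$. Then $\varphi$ is a $G$-quasi-invariant (in particular faithful and normal) state, its cocycle is $x_g=d\,g^{-1}(d^{-1})$, and this cocycle satisfies (A). -/

import Mathlib

open scoped ComplexOrder Topology

namespace QuasiInvariant

universe u v

variable {H : Type u} [NormedAddCommGroup H] [InnerProductSpace ℂ H] [CompleteSpace H]

/-- The elements of a von Neumann algebra `M ⊆ B(H)`, as a unital `*`-algebra with the operator
norm. -/
abbrev Elem (M : VonNeumannAlgebra H) : Type u := M.toStarSubalgebra

/-- The functional `a ↦ ∑ₙ ⟪ξₙ, a ηₙ⟫` on `M` attached to two square-summable sequences of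
vectors. -/
noncomputable def sigmaWeakFunctional (M : VonNeumannAlgebra H) (ξ η : lp (fun _ : ℕ => H) 2)
    (a : Elem M) : ℂ :=
  ∑' n, inner ℂ (ξ n) ((a : H →L[ℂ] H) (η n))

/-- The series defining `sigmaWeakFunctional` always converges (absolutely). -/
theorem summable_sigmaWeakFunctional (M : VonNeumannAlgebra H) (ξ η : lp (fun _ : ℕ => H) 2)
    (a : Elem M) : Summable fun n => inner ℂ (ξ n) ((a : H →L[ℂ] H) (η n)) := by
  have h2 : (0 : ℝ) < (2 : ENNReal).toReal := by norm_num
  have hξ : Summable fun n => ‖ξ n‖ ^ 2 := by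
    simpa using (lp.memℓp ξ).summable h2
  have hη : Summable fun n => ‖η n‖ ^ 2 := by
    simpa using (lp.memℓp η).summable h2
  refine Summable.of_norm_bounded ((hξ.add hη).mul_left ‖(a : H →L[ℂ] H)‖) fun n => ?_
  have h1 := norm_inner_le_norm (𝕜 := ℂ) (ξ n) ((a : H →L[ℂ] H) (η n))
  have h3 := (a : H →L[ℂ] H).le_opNorm (η n)
  have h4 : ‖ξ n‖ * ‖η n‖ ≤ ‖ξ n‖ ^ 2 + ‖η n‖ ^ 2 := by
    nlinarith [sq_nonneg (‖ξ n‖ - ‖η n‖), sq_nonneg ‖ξ n‖, sq_nonneg ‖η n‖]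
  calc _ ≤ ‖ξ n‖ * ‖(a : H →L[ℂ] H) (η n)‖ := h1
    _ ≤ ‖ξ n‖ * (‖(a : H →L[ℂ] H)‖ * ‖η n‖) := by gcongr
    _ = ‖(a : H →L[ℂ] H)‖ * (‖ξ n‖ * ‖η n‖) := by ring
    _ ≤ _ := by gcongr

/-- The `σ`-weak (ultraweak) topology on `M`: the coarsest topology making all the functionals
`a ↦ ∑ₙ ⟪ξₙ, a ηₙ⟫` continuous. -/
@[reducible]
noncomputable def sigmaWeakTopology (M : VonNeumannAlgebra H) : TopologicalSpace (Elem M) :=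
  ⨅ p : lp (fun _ : ℕ => H) 2 × lp (fun _ : ℕ => H) 2,
    TopologicalSpace.induced (sigmaWeakFunctional M p.1 p.2) inferInstance

/-- A linear functional is normal if it is `σ`-weakly continuous. -/
def IsNormalFunctional {M : VonNeumannAlgebra H} (φ : Elem M →ₗ[ℂ] ℂ) : Prop :=
  Continuous[sigmaWeakTopology M, inferInstance] φ

/-- A `*`-automorphism is normal if it is `σ`-weakly continuous. -/
def IsNormalAut {M : VonNeumannAlgebra H} (θ : Elem M ≃⋆ₐ[ℂ] Elem M) : Prop :=
  Continuous[sigmaWeakTopology M, sigmaWeakTopology M] θ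

/-- A state: a positive linear functional of value `1` at the unit. -/
structure IsState {M : VonNeumannAlgebra H} (φ : Elem M →ₗ[ℂ] ℂ) : Prop where
  nonneg : ∀ a, 0 ≤ φ (star a * a)
  map_one : φ 1 = 1

/-- Faithfulness of a positive functional. -/
def IsFaithful {M : VonNeumannAlgebra H} (φ : Elem M →ₗ[ℂ] ℂ) : Prop :=
  ∀ a, φ (star a * a) = 0 → a = 0

/-- A faithful normal state. -/
structure IsFaithfulNormalState {M : VonNeumannAlgebra H} (φ : Elem M →ₗ[ℂ] ℂ) : Prop where
  isState : IsState φ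
  normal : IsNormalFunctional φ
  faithful : IsFaithful φ

section Action

variable {M : VonNeumannAlgebra H} {G : Type v} [Group G]

/-- `φ` is `G`-invariant: `φ ∘ g = φ` for all `g`. -/
def IsInvariant (α : G →* (Elem M ≃⋆ₐ[ℂ] Elem M)) (φ : Elem M →ₗ[ℂ] ℂ) : Prop :=
  ∀ g a, φ (α g a) = φ a

/-- `x` is the (Radon-Nikodym) cocycle of `φ`: `φ (g a) = φ (x_g a)` for all `g` and `a`. For a
faithful state such a family is unique. -/
def IsCocycle (α : G →* (Elem M ≃⋆ₐ[ℂ] Elem M)) (φ : Elem M →ₗ[ℂ] ℂ) (x : G → Elem M) : Prop :=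
  ∀ g a, φ (α g a) = φ (x g * a)

/-- The cocycle of a faithful state is unique. -/
theorem IsCocycle.eq {α : G →* (Elem M ≃⋆ₐ[ℂ] Elem M)} {φ : Elem M →ₗ[ℂ] ℂ} {x y : G → Elem M}
    (hφ : IsFaithful φ) (hx : IsCocycle α φ x) (hy : IsCocycle α φ y) : x = y := by
  funext g
  have h := hφ (star (x g - y g)) (by
    rw [star_star, sub_mul, map_sub, ← hx g, ← hy g, sub_self])
  exact sub_eq_zero.mp (star_eq_zero.mp h)

/-- A `G`-quasi-invariant state: a faithful normal state such that for each `g` there is `x_g` in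
`M` with `φ (g a) = φ (x_g a)` for all `a`. -/
structure IsQuasiInvariant (α : G →* (Elem M ≃⋆ₐ[ℂ] Elem M)) (φ : Elem M →ₗ[ℂ] ℂ) : Prop where
  isFaithfulNormalState : IsFaithfulNormalState φ
  exists_derivative : ∀ g, ∃ y : Elem M, ∀ a, φ (α g a) = φ (y * a)

/-- Uniform boundedness in operator norm: `‖x_g‖ ≤ lam` for all `g`, for some `lam > 0`. -/
def IsUniformlyBounded (x : G → Elem M) : Prop :=
  ∃ lam : ℝ, 0 < lam ∧ ∀ g, ‖x g‖ ≤ lam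

end Action

end QuasiInvariant

/-!
The von Neumann algebra `M` embeds into its normal functionals by `y ↦ φ (y * ·)`, and composition
with `α g` becomes the twisted action `y ↦ x g * α g⁻¹ y`, which permutes the cocycle `x`. An
invariant state of the required form is a fixed point of this action in the weakly closed convex
hull of the cocycle.

The fixed point is obtained without a general fixed point theorem. If `‖x g‖ ≤ lam` for all `g`, then
`φ ∘ α g ≤ lam • φ` on positive elements (`re_map_mul_le`, an iterated Cauchy–Schwarz inequality), so
the twisted action is uniformly bounded for the Hilbert norm `φ (u * star u)`
(`IsCocycle.map_twist_mul_star_le`). The supremum of this squared norm over the action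
(`supNormSq`) is invariant, and it is still uniformly convex, as a supremum of uniformly equivalent
quadratic forms (`le_of_almost_minimizers`). If `y n` is a minimizing sequence in the convex hull of
the cocycle, then so is its image under each `g`, and uniform convexity makes the two asymptotically
equal. A weak operator limit `d` of `y n`, which exists in `M` because bounded sets are compact
(`exists_tendsto_inner`), therefore gives an invariant normal functional `φ (d * ·)`. It is faithful
since every `φ (y n * ·)` dominates `lam⁻¹ • φ`.

Conversely, if `ψ = φ (d * ·)` is invariant with `d` invertible, then `φ = ψ (d⁻¹ * ·)`. Normality
and the cocycle formula follow by computation, faithfulness by Cauchy–Schwarz, and the bound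
`‖d‖ * ‖d⁻¹‖` holds because `*`-automorphisms are isometric.
-/

open scoped ComplexOrder Topology

namespace QuasiInvariant

/-! ### Positive functionals on `*`-algebras -/

section PositiveFunctional

variable {A : Type*} [Ring A] [StarRing A] [Algebra ℂ A] [StarModule ℂ A]

theorem map_star_of_nonneg {ω : A →ₗ[ℂ] ℂ} (hω : ∀ a, 0 ≤ ω (star a * a)) (a : A) :
    ω (star a) = star (ω a) := by
  have h0 := (Complex.nonneg_iff.mp (hω a)).2
  have h1 := (Complex.nonneg_iff.mp (hω 1)).2
  have h2 := (Complex.nonneg_iff.mp (hω (1 + a))).2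
  have h3 := (Complex.nonneg_iff.mp (hω (1 + Complex.I • a))).2
  simp [add_mul, mul_add] at h0 h1 h2 h3
  apply Complex.ext
  · simp
    linarith
  · simp
    linarith

/-- The Cauchy–Schwarz inequality for the form `(a, b) ↦ ω (star a * b)`. -/
theorem norm_map_star_mul_sq_le {ω : A →ₗ[ℂ] ℂ} (hω : ∀ a, 0 ≤ ω (star a * a)) (a b : A) :
    ‖ω (star a * b)‖ ^ 2 ≤ (ω (star a * a)).re * (ω (star b * b)).re := by
  have hs : ∀ x y : A, star (ω (star y * x)) = ω (star x * y) := fun x y => by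
    rw [← map_star_of_nonneg hω, star_mul, star_star]
  let c : PreInnerProductSpace.Core ℂ A :=
    { inner := fun x y => ω (star x * y)
      conj_inner_symm := fun x y => hs x y
      re_inner_nonneg := fun x => (Complex.nonneg_iff.mp (hω x)).1
      add_left := fun x y z => by simp [add_mul]
      smul_left := fun x y r => by simp }
  have h := @InnerProductSpace.Core.inner_mul_inner_self_le ℂ A _ _ _ c a b
  change ‖ω (star a * b)‖ * ‖ω (star b * a)‖ ≤ (ω (star a * a)).re * (ω (star b * b)).re at h
  rwa [← hs b a, norm_star, ← sq] at h

theorem norm_map_mul_sq_le {ω : A →ₗ[ℂ] ℂ} (hω : ∀ a, 0 ≤ ω (star a * a)) (a b : A) :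
    ‖ω (a * b)‖ ^ 2 ≤ (ω (a * star a)).re * (ω (star b * b)).re := by
  simpa using norm_map_star_mul_sq_le hω (star a) b

/-- If `ω` and `ω (x * ·)` are positive, so is `ω (x ^ 2 * ·)`, because the hermitian functional
`ω (x * ·)` satisfies `ω (x ^ 2 * (star a * a)) = ω ((x * star a) * star (x * star a))`. The second
part is then Cauchy–Schwarz. -/
theorem nonneg_mul_sq {ω : A →ₗ[ℂ] ℂ} {x : A} (hω : ∀ a, 0 ≤ ω (star a * a))
    (hx : ∀ a, 0 ≤ ω (x * (star a * a))) (a : A) :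
    0 ≤ ω (x ^ 2 * (star a * a)) ∧
      (ω (x * (star a * a))).re ^ 2 ≤ (ω (x ^ 2 * (star a * a))).re * (ω (star a * a)).re := by
  let ωx : A →ₗ[ℂ] ℂ := ω ∘ₗ LinearMap.mulLeft ℂ x
  -- The hermitian symmetry of `ωx` moves `x` across; the value is real, so conjugation is harmless.
  have key : ω (x * star a * star (x * star a)) = ω (x ^ 2 * (star a * a)) := by
    have h1 : ω (x * star a * star (x * star a)) = ωx (star (x * (star a * a))) := by
      simp [ωx, mul_assoc]
    have h2 : ωx (x * (star a * a)) = ω (x ^ 2 * (star a * a)) := by simp [ωx, sq, mul_assoc]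
    have h3 := hω (star (x * star a))
    rw [star_star] at h3
    rw [h1, map_star_of_nonneg (ω := ωx) hx] at *
    have := Complex.conj_eq_iff_im.mpr (Complex.nonneg_iff.mp h3).2.symm
    simp only [Complex.star_def, Complex.conj_conj] at *
    rw [← this, h2]
  refine ⟨?_, ?_⟩
  · rw [← key]
    simpa using hω (star (x * star a))
  · have h := norm_map_mul_sq_le hω (x * star a) a
    rw [key, mul_assoc] at h
    refine le_trans ?_ h
    exact sq_le_sq.mpr (by simpa using Complex.abs_re_le_norm _)

theorem map_mul_eq_zero_of_map_star_mul_self {ω : A →ₗ[ℂ] ℂ} (hω : ∀ a, 0 ≤ ω (star a * a))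
    {a : A} (ha : ω (star a * a) = 0) (b : A) : ω (b * a) = 0 := by
  have h := norm_map_mul_sq_le hω b a
  rw [ha, Complex.zero_re, mul_zero] at h
  exact norm_eq_zero.mp (pow_eq_zero_iff two_ne_zero |>.mp (le_antisymm h (sq_nonneg _)))

end PositiveFunctional

/-- If `ω` and `ω (x * ·)` are positive and `‖x‖ ≤ lam`, then `ω (x * ·) ≤ lam • ω`. Iterating
`nonneg_mul_sq` bounds `(ω (x * (star a * a)) / ω (star a * a)) ^ (2 ^ n)` by a constant multiple of
`lam ^ (2 ^ n)`, and the constant disappears as `n → ∞`. -/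
theorem re_map_mul_le {A : Type*} [NormedRing A] [StarRing A] [NormedAlgebra ℂ A] [StarModule ℂ A]
    {ω : A →ₗ[ℂ] ℂ} {x : A} {lam K : ℝ} (hω : ∀ a, 0 ≤ ω (star a * a))
    (hx : ∀ a, 0 ≤ ω (x * (star a * a))) (hK : ∀ a, ‖ω a‖ ≤ K * ‖a‖) (hlam : 0 < lam)
    (hxlam : ‖x‖ ≤ lam) (a : A) :
    (ω (x * (star a * a))).re ≤ lam * (ω (star a * a)).re := by
  set t := (ω (star a * a)).re
  set s : ℕ → ℝ := fun n => (ω (x ^ (2 ^ n) * (star a * a))).re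
  have ht : 0 ≤ t := (Complex.nonneg_iff.mp (hω a)).1
  have hpos : ∀ n, ∀ b, 0 ≤ ω (x ^ (2 ^ n) * (star b * b)) := by
    intro n
    induction n with
    | zero => simpa using hx
    | succ n ih =>
      intro b
      rw [pow_succ 2 n, pow_mul]
      exact (nonneg_mul_sq hω ih b).1
  have hs0 : ∀ n, 0 ≤ s n := fun n => (Complex.nonneg_iff.mp (hpos n a)).1
  have hstep : ∀ n, s n ^ 2 ≤ s (n + 1) * t := by
    intro n
    have h := (nonneg_mul_sq hω (hpos n) a).2
    rwa [← pow_mul, ← pow_succ] at h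
  have hbound : ∀ n, s n ≤ |K| * ‖star a * a‖ * lam ^ (2 ^ n) := by
    intro n
    have hn : 0 < 2 ^ n := by positivity
    calc s n ≤ ‖ω (x ^ (2 ^ n) * (star a * a))‖ := Complex.re_le_norm _
      _ ≤ |K| * ‖x ^ (2 ^ n) * (star a * a)‖ :=
        (hK _).trans (mul_le_mul_of_nonneg_right (le_abs_self K) (norm_nonneg _))
      _ ≤ |K| * (‖x‖ ^ (2 ^ n) * ‖star a * a‖) := by
        gcongr
        exact (norm_mul_le _ _).trans (by gcongr; exact norm_pow_le' x hn)
      _ ≤ |K| * (lam ^ (2 ^ n) * ‖star a * a‖) := by gcongr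
      _ = _ := by ring
  -- If `t = 0` then `s 0 = 0`; otherwise `s 0 > lam * t` would make `(s 0 / (lam * t)) ^ (2 ^ n)`
  -- both unbounded and bounded by `|K| * ‖star a * a‖ / t`.
  have hgoal : s 0 ≤ lam * t := by
    rcases ht.eq_or_lt with h | h
    · have := hstep 0
      rw [← h] at this ⊢
      nlinarith [hs0 0]
    · by_contra! hlt
      have hr : 1 < s 0 / (lam * t) := (one_lt_div (by positivity)).mpr hlt
      have hiter : ∀ n, (s 0 / t) ^ (2 ^ n) ≤ s n / t := by
        intro n
        induction n with
        | zero => simp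
        | succ n ih =>
          rw [pow_succ 2 n, pow_mul]
          have h0 : 0 ≤ (s 0 / t) ^ (2 ^ n) := pow_nonneg (div_nonneg (hs0 0) ht) _
          calc ((s 0 / t) ^ (2 ^ n)) ^ 2 ≤ (s n / t) ^ 2 := by gcongr
            _ = s n ^ 2 / t ^ 2 := div_pow _ _ _
            _ ≤ s (n + 1) * t / t ^ 2 := by gcongr; exact hstep n
            _ = s (n + 1) / t := by field_simp
      obtain ⟨n, hn⟩ := pow_unbounded_of_one_lt (|K| * ‖star a * a‖ / t) hr
      have h2 : (s 0 / (lam * t)) ^ n ≤ (s 0 / (lam * t)) ^ (2 ^ n) :=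
        pow_le_pow_right₀ hr.le Nat.lt_two_pow_self.le
      have h3 : (s 0 / (lam * t)) ^ (2 ^ n) = (s 0 / t) ^ (2 ^ n) / lam ^ (2 ^ n) := by
        rw [← div_pow]; congr 1; field_simp
      have h4 : (s 0 / t) ^ (2 ^ n) / lam ^ (2 ^ n) ≤ |K| * ‖star a * a‖ / t := by
        rw [div_le_iff₀ (by positivity)]
        calc _ ≤ s n / t := hiter n
          _ ≤ |K| * ‖star a * a‖ * lam ^ (2 ^ n) / t := by gcongr; exact hbound n
          _ = _ := by ring
      linarith
  simpa [s] using hgoal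

/-! ### Almost minimizers of a supremum of quadratic forms -/

/-- A supremum of quadratic forms `Q i` that are uniformly bounded below by a multiple of `P` is
uniformly convex with respect to `P`: two points of a convex set that minimize `⨆ i, Q i` up to `ε`
are close for `P`. -/
theorem le_of_almost_minimizers {E ι : Type*} [AddCommGroup E] [Module ℝ E] [Nonempty ι]
    {Q : ι → E → ℝ} {P : E → ℝ} {K ε : ℝ} {C : Set E} (hC : Convex ℝ C)
    (hQ0 : ∀ i u, 0 ≤ Q i u)
    (hpar : ∀ i u v, Q i (u + v) + Q i (u - v) = 2 * Q i u + 2 * Q i v)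
    (hsmul : ∀ i u (r : ℝ), Q i (r • u) = r ^ 2 * Q i u)
    (hbdd : ∀ u, BddAbove (Set.range fun i => Q i u)) (hK : 0 < K)
    (hPQ : ∀ i u, P u ≤ K * Q i u) {u v : E} (hu : u ∈ C) (hv : v ∈ C)
    (hqu : ⨆ i, Q i u ≤ sInf ((fun w => ⨆ i, Q i w) '' C) + ε)
    (hqv : ⨆ i, Q i v ≤ sInf ((fun w => ⨆ i, Q i w) '' C) + ε) :
    P (u - v) ≤ 4 * K * ε := by
  set I := sInf ((fun w => ⨆ i, Q i w) '' C)
  have hm : (1 / 2 : ℝ) • (u + v) ∈ C := by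
    rw [smul_add]
    exact hC hu hv (by norm_num) (by norm_num) (by norm_num)
  have hI : I ≤ ⨆ i, Q i ((1 / 2 : ℝ) • (u + v)) :=
    csInf_le ⟨0, by rintro _ ⟨w, -, rfl⟩; exact Real.iSup_nonneg fun i => hQ0 i w⟩ ⟨_, hm, rfl⟩
  have hle : ⨆ i, Q i ((1 / 2 : ℝ) • (u + v)) ≤ I + ε - P (u - v) / (4 * K) := by
    refine ciSup_le fun i => ?_
    have h1 := (le_ciSup (hbdd u) i).trans hqu
    have h2 := (le_ciSup (hbdd v) i).trans hqv
    have h3 : P (u - v) / (4 * K) ≤ Q i (u - v) / 4 := by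
      rw [div_le_iff₀ (by positivity)]
      linarith [hPQ i (u - v)]
    rw [hsmul]
    linarith [hpar i u v]
  have h := hI.trans hle
  have h' : P (u - v) / (4 * K) ≤ ε := by linarith
  rwa [div_le_iff₀ (by positivity), mul_comm] at h'

open Filter

universe u v

variable {H : Type u} [NormedAddCommGroup H] [InnerProductSpace ℂ H] [CompleteSpace H]

/-! ### Normal functionals and weak operator limits -/

/-- On norm-bounded sets the weak operator topology is finer than the `σ`-weak topology, so normal
functionals respect bounded weak operator limits. -/
theorem tendsto_of_tendsto_inner {M : VonNeumannAlgebra H} {φ : Elem M →ₗ[ℂ] ℂ}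
    (hφ : IsNormalFunctional φ) {ι : Type*} {l : Filter ι} {y : ι → Elem M} {d : Elem M} {lam : ℝ}
    (hy : ∀ᶠ i in l, ‖y i‖ ≤ lam)
    (hd : ∀ ξ η : H, Tendsto (fun i => inner ℂ ξ ((y i : H →L[ℂ] H) η)) l
      (𝓝 (inner ℂ ξ ((d : H →L[ℂ] H) η)))) :
    Tendsto (fun i => φ (y i)) l (𝓝 (φ d)) := by
  have h2 : (0 : ℝ) < (2 : ENNReal).toReal := by norm_num
  have hsq : ∀ ξ : lp (fun _ : ℕ => H) 2, Summable fun n => ‖ξ n‖ ^ 2 := fun ξ => by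
    simpa using (lp.memℓp ξ).summable h2
  have hc : Tendsto φ (@nhds _ (sigmaWeakTopology M) d) (𝓝 (φ d)) :=
    @Continuous.tendsto _ _ (sigmaWeakTopology M) _ _ hφ d
  refine hc.comp ?_
  simp only [nhds_iInf, nhds_induced, tendsto_iInf, tendsto_comap_iff]
  rintro ⟨ξ, η⟩
  refine tendsto_tsum_of_dominated_convergence
    (bound := fun n => lam * (‖ξ n‖ ^ 2 + ‖η n‖ ^ 2)) (((hsq ξ).add (hsq η)).mul_left _)
    (fun n => hd _ _) ?_
  filter_upwards [hy] with i hi n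
  have hl : 0 ≤ lam := (norm_nonneg _).trans hi
  calc _ ≤ ‖ξ n‖ * ‖(y i : H →L[ℂ] H) (η n)‖ := norm_inner_le_norm _ _
    _ ≤ ‖ξ n‖ * (lam * ‖η n‖) := by
      gcongr
      exact (y i : H →L[ℂ] H).le_of_opNorm_le hi _
    _ = lam * (‖ξ n‖ * ‖η n‖) := by ring
    _ ≤ _ := by
      gcongr
      nlinarith [sq_nonneg (‖ξ n‖ - ‖η n‖), sq_nonneg ‖ξ n‖, sq_nonneg ‖η n‖]

theorem IsNormalFunctional.exists_bound {M : VonNeumannAlgebra H} {φ : Elem M →ₗ[ℂ] ℂ}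
    (hφ : IsNormalFunctional φ) : ∃ K : ℝ, ∀ a, ‖φ a‖ ≤ K * ‖a‖ := by
  have hc : Continuous φ := by
    refine continuous_iff_continuousAt.mpr fun a => ?_
    refine tendsto_of_tendsto_inner hφ (lam := ‖a‖ + 1) ?_ fun ξ η => ?_
    · exact (continuous_norm.tendsto a).eventually (ge_mem_nhds (by linarith))
    · have : Continuous fun b : Elem M => inner ℂ ξ ((b : H →L[ℂ] H) η) := by fun_prop
      exact this.tendsto a
  exact ⟨‖(⟨φ, hc⟩ : Elem M →L[ℂ] ℂ)‖, fun a => (⟨φ, hc⟩ : Elem M →L[ℂ] ℂ).le_opNorm a⟩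

theorem IsNormalFunctional.comp_mulLeft {M : VonNeumannAlgebra H} {φ : Elem M →ₗ[ℂ] ℂ}
    (hφ : IsNormalFunctional φ) (d : Elem M) :
    IsNormalFunctional (φ ∘ₗ LinearMap.mulLeft ℂ d) := by
  have hL : Continuous[sigmaWeakTopology M, sigmaWeakTopology M] fun a : Elem M => d * a := by
    refine continuous_iInf_rng.mpr fun p => continuous_induced_rng.mpr ?_
    obtain ⟨ξ, η⟩ := p
    have hmem : Memℓp (fun n => star (d : H →L[ℂ] H) (ξ n)) 2 := by
      have h2 : (0 : ℝ) < (2 : ENNReal).toReal := by norm_num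
      refine (((lp.memℓp ξ).norm.const_mul ‖star (d : H →L[ℂ] H)‖)).mono' fun n => ?_
      exact ((star (d : H →L[ℂ] H)).le_opNorm _).trans (le_abs_self _)
    -- `⟪ξₙ, d a ηₙ⟫ = ⟪d⋆ ξₙ, a ηₙ⟫`.
    have heq : (sigmaWeakFunctional M ξ η ∘ fun a : Elem M => d * a) =
        sigmaWeakFunctional M ⟨_, hmem⟩ η := by
      funext a
      simp [sigmaWeakFunctional, ContinuousLinearMap.star_eq_adjoint,
        ContinuousLinearMap.adjoint_inner_left]
    rw [heq]
    exact continuous_iInf_dom (i := (⟨_, hmem⟩, η)) continuous_induced_dom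
  exact @Continuous.comp _ _ _ (sigmaWeakTopology M) (sigmaWeakTopology M) _ _ φ hφ hL

/-- The unit ball of a von Neumann algebra is compact for the weak operator topology: a bounded family
in `M` has a weak operator limit in `M` along any ultrafilter. The limit of the forms
`⟪yᵢ v, w⟫` is a bounded sesquilinear form, and the operator representing it lies in the double
commutant. -/
theorem exists_tendsto_inner (M : VonNeumannAlgebra H) {ι : Type*} (U : Ultrafilter ι)
    {y : ι → Elem M} {lam : ℝ} (hy : ∀ i, ‖y i‖ ≤ lam) :
    ∃ d : Elem M, ∀ ξ η : H, Tendsto (fun i => inner ℂ ξ ((y i : H →L[ℂ] H) η)) U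
      (𝓝 (inner ℂ ξ ((d : H →L[ℂ] H) η))) := by
  have hb : ∀ i (v w : H), ‖inner ℂ ((y i : H →L[ℂ] H) v) w‖ ≤ lam * ‖v‖ * ‖w‖ := fun i v w =>
    (norm_inner_le_norm _ _).trans
      (by gcongr; exact (y i : H →L[ℂ] H).le_of_opNorm_le (hy i) _)
  have hex : ∀ v w : H, ∃ z ∈ Metric.closedBall (0 : ℂ) (lam * ‖v‖ * ‖w‖),
      Tendsto (fun i => inner ℂ ((y i : H →L[ℂ] H) v) w) U (𝓝 z) := fun v w =>
    (isCompact_closedBall (0 : ℂ) (lam * ‖v‖ * ‖w‖)).ultrafilter_le_nhds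
      (U.map fun i => inner ℂ ((y i : H →L[ℂ] H) v) w)
      (by
        rw [le_principal_iff]
        exact Filter.mem_map.mpr (Filter.univ_mem' fun i => by simpa using hb i v w))
  choose B hB hBt using hex
  let B' : H →ₗ⋆[ℂ] H →ₗ[ℂ] ℂ := LinearMap.mk₂'ₛₗ (starRingEnd ℂ) (RingHom.id ℂ) B
    (fun v v' w => tendsto_nhds_unique (hBt _ _)
      (by simpa [inner_add_left] using (hBt v w).add (hBt v' w)))
    (fun c v w => tendsto_nhds_unique (hBt _ _)
      (by simpa [inner_smul_left, mul_comm] using (hBt v w).const_mul (starRingEnd ℂ c)))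
    (fun v w w' => tendsto_nhds_unique (hBt _ _)
      (by simpa [inner_add_right] using (hBt v w).add (hBt v w')))
    (fun c v w => tendsto_nhds_unique (hBt _ _)
      (by simpa [inner_smul_right] using (hBt v w).const_mul _))
  let d : H →L[ℂ] H := InnerProductSpace.continuousLinearMapOfBilin
    (B'.mkContinuous₂ lam fun v w => mem_closedBall_zero_iff.mp (hB v w))
  have hd' : ∀ v w, Tendsto (fun i => inner ℂ ((y i : H →L[ℂ] H) v) w) U
      (𝓝 (inner ℂ (d v) w)) := fun v w => by
    have : inner ℂ (d v) w = B v w := by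
      simp only [d, InnerProductSpace.continuousLinearMapOfBilin_apply]
      rfl
    rw [this]
    exact hBt v w
  have hd : ∀ ξ η : H, Tendsto (fun i => inner ℂ ξ ((y i : H →L[ℂ] H) η)) U
      (𝓝 (inner ℂ ξ (d η))) := fun ξ η => by
    simpa [Function.comp_def] using (Complex.continuous_conj.tendsto _).comp (hd' η ξ)
  have hmem : d ∈ (M : Set (H →L[ℂ] H)) := by
    rw [← M.centralizer_centralizer]
    intro c hc
    ext η
    refine ext_inner_left ℂ fun ξ => ?_
    refine tendsto_nhds_unique (f := fun i => inner ℂ ξ (c ((y i : H →L[ℂ] H) η))) (l := U) ?_ ?_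
    · simpa [ContinuousLinearMap.adjoint_inner_left] using
        hd (ContinuousLinearMap.adjoint c ξ) η
    · have hcomm : ∀ i, c ((y i : H →L[ℂ] H) η) = (y i : H →L[ℂ] H) (c η) := fun i =>
        congr($((hc (y i) (y i).2).symm) η)
      simpa [hcomm] using hd ξ (c η)
  exact ⟨⟨d, hmem⟩, hd⟩

theorem norm_starAlgEquiv_apply (M : VonNeumannAlgebra H) (θ : Elem M ≃⋆ₐ[ℂ] Elem M) (a : Elem M) :
    ‖θ a‖ = ‖a‖ := by
  have hcl : IsClosed (M.toStarSubalgebra : Set (H →L[ℂ] H)) := by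
    rw [VonNeumannAlgebra.coe_toStarSubalgebra, ← M.centralizer_centralizer]
    exact Set.isClosed_centralizer _
  have : IsClosed (M.toStarSubalgebra : Set (H →L[ℂ] H)) := hcl
  let _ : CStarAlgebra (Elem M) := StarSubalgebra.cstarAlgebra M.toStarSubalgebra
  exact NonUnitalStarAlgHom.norm_map θ θ.injective a

/-! ### The twisted action on the algebra -/

section Twist

variable {M : VonNeumannAlgebra H} {G : Type v} [Group G]

theorem IsFaithful.eq_of_forall_mul {φ : Elem M →ₗ[ℂ] ℂ} (hφ : IsFaithful φ) {u v : Elem M}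
    (h : ∀ a, φ (u * a) = φ (v * a)) : u = v := by
  have h := hφ (star (u - v)) (by rw [star_star, sub_mul, map_sub, h, sub_self])
  exact sub_eq_zero.mp (star_eq_zero.mp h)

theorem re_map_mul_star_nonneg {φ : Elem M →ₗ[ℂ] ℂ} (hφ : ∀ a, 0 ≤ φ (star a * a)) (u : Elem M) :
    0 ≤ (φ (u * star u)).re := by
  simpa using (Complex.nonneg_iff.mp (hφ (star u))).1

/-- The right action of `G` on `M` dual to `α`: under the embedding `y ↦ φ (y * ·)` of `M` into
the functionals, it is `ω ↦ ω ∘ α g`. -/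
noncomputable def twist (α : G →* (Elem M ≃⋆ₐ[ℂ] Elem M)) (x : G → Elem M) (g : G) : Elem M →ₗ[ℂ] Elem M where
  toFun y := x g * α g⁻¹ y
  map_add' y z := by simp [mul_add]
  map_smul' c y := by simp

variable {α : G →* (Elem M ≃⋆ₐ[ℂ] Elem M)} {x : G → Elem M} {φ : Elem M →ₗ[ℂ] ℂ}

theorem IsCocycle.map_twist_mul (hx : IsCocycle α φ x) (g : G) (y a : Elem M) :
    φ (twist α x g y * a) = φ (y * α g a) := by
  have h : y * α g a = α g (α g⁻¹ y * a) := by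
    rw [map_mul, ← StarAlgEquiv.mul_apply, ← map_mul, mul_inv_cancel, map_one,
      StarAlgEquiv.one_apply]
  rw [h, hx, ← mul_assoc]
  rfl

theorem IsCocycle.twist_twist (hφ : IsFaithful φ) (hx : IsCocycle α φ x) (g h : G) (y : Elem M) :
    twist α x g (twist α x h y) = twist α x (h * g) y :=
  hφ.eq_of_forall_mul fun a => by
    rw [hx.map_twist_mul, hx.map_twist_mul, hx.map_twist_mul, map_mul α, StarAlgEquiv.mul_apply]

theorem IsCocycle.twist_one (hφ : IsFaithful φ) (hx : IsCocycle α φ x) (y : Elem M) :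
    twist α x 1 y = y :=
  hφ.eq_of_forall_mul fun a => by rw [hx.map_twist_mul, map_one, StarAlgEquiv.one_apply]

theorem IsCocycle.twist_derivative (hφ : IsFaithful φ) (hx : IsCocycle α φ x) (g h : G) :
    twist α x g (x h) = x (h * g) :=
  hφ.eq_of_forall_mul fun a => by
    rw [hx.map_twist_mul, ← hx, ← hx, map_mul, StarAlgEquiv.mul_apply]

/-- A bounded cocycle forces `φ ∘ α g ≤ lam • φ` on positive elements. -/
theorem IsCocycle.re_map_apply_le {lam : ℝ} (hφ : IsFaithfulNormalState φ) (hx : IsCocycle α φ x)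
    (hlam : 0 < lam) (hxlam : ∀ g, ‖x g‖ ≤ lam) (g : G) (a : Elem M) :
    (φ (α g (star a * a))).re ≤ lam * (φ (star a * a)).re := by
  obtain ⟨K, hK⟩ := hφ.normal.exists_bound
  rw [hx]
  refine re_map_mul_le hφ.isState.nonneg (fun b => ?_) hK hlam (hxlam g) a
  rw [← hx, map_mul, map_star]
  exact hφ.isState.nonneg _

/-- The twisted action is bounded for `u ↦ φ (u * star u)`: for `w = twist g u` one has
`φ (w * star w) = φ (u * α g (star w))`, and Cauchy–Schwarz together with `φ ∘ α g ≤ lam • φ` leaves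
`φ (w * star w)` on both sides. -/
theorem IsCocycle.map_twist_mul_star_le {lam : ℝ} (hφ : IsFaithfulNormalState φ)
    (hx : IsCocycle α φ x) (hlam : 0 < lam) (hxlam : ∀ g, ‖x g‖ ≤ lam) (g : G) (u : Elem M) :
    (φ (twist α x g u * star (twist α x g u))).re ≤ lam * (φ (u * star u)).re := by
  have hpos := hφ.isState.nonneg
  set w := twist α x g u with hw
  have hu0 := re_map_mul_star_nonneg hpos u
  have hw0 := re_map_mul_star_nonneg hpos w
  have h1 : (φ (w * star w)).re ^ 2 ≤ (φ (u * star u)).re * (lam * (φ (w * star w)).re) := by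
    calc (φ (w * star w)).re ^ 2 ≤ ‖φ (w * star w)‖ ^ 2 :=
          sq_le_sq.mpr (by simpa using Complex.abs_re_le_norm _)
      _ = ‖φ (u * α g (star w))‖ ^ 2 := by rw [hw, hx.map_twist_mul]
      _ ≤ (φ (u * star u)).re * (φ (star (α g (star w)) * α g (star w))).re :=
          norm_map_mul_sq_le hpos _ _
      _ ≤ (φ (u * star u)).re * (lam * (φ (w * star w)).re) := by
          gcongr
          have := hx.re_map_apply_le hφ hlam hxlam g (star w)
          rw [map_mul (α g), map_star (α g), star_star] at this
          exact this
  rcases hw0.eq_or_lt with h | h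
  · rw [← h]; positivity
  · refine le_of_mul_le_mul_right ?_ h
    linarith

/-- The `G`-invariant square of a norm on `M`, equivalent to `u ↦ φ (u * star u)`. -/
noncomputable def supNormSq (α : G →* (Elem M ≃⋆ₐ[ℂ] Elem M)) (x : G → Elem M)
    (φ : Elem M →ₗ[ℂ] ℂ) (u : Elem M) : ℝ :=
  ⨆ g, (φ (twist α x g u * star (twist α x g u))).re

theorem IsCocycle.supNormSq_twist (hφ : IsFaithful φ) (hx : IsCocycle α φ x) (h : G) (u : Elem M) :
    supNormSq α x φ (twist α x h u) = supNormSq α x φ u := by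
  simp only [supNormSq, hx.twist_twist hφ]
  exact (Equiv.mulLeft h).iSup_comp
    (g := fun g => (φ (twist α x g u * star (twist α x g u))).re)

/-- Almost minimizers of `supNormSq` on a convex set are close in the norm of `φ (u * star u)`.
The lower bound on the quadratic forms comes from applying the boundedness of the twisted action to
`g⁻¹`. -/
theorem IsCocycle.map_sub_mul_star_le {lam ε : ℝ} (hφ : IsFaithfulNormalState φ)
    (hx : IsCocycle α φ x) (hlam : 0 < lam) (hxlam : ∀ g, ‖x g‖ ≤ lam) {C : Set (Elem M)}
    (hC : Convex ℝ C) {u v : Elem M} (hu : u ∈ C) (hv : v ∈ C)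
    (hqu : supNormSq α x φ u ≤ sInf (supNormSq α x φ '' C) + ε)
    (hqv : supNormSq α x φ v ≤ sInf (supNormSq α x φ '' C) + ε) :
    (φ ((u - v) * star (u - v))).re ≤ 4 * lam * ε := by
  refine le_of_almost_minimizers (P := fun w => (φ (w * star w)).re)
    (Q := fun g u => (φ (twist α x g u * star (twist α x g u))).re) hC
    (fun g u => re_map_mul_star_nonneg hφ.isState.nonneg _) (fun g u v => ?_) (fun g u r => ?_)
    (fun u => ⟨lam * (φ (u * star u)).re, ?_⟩) hlam (fun g u => ?_) hu hv hqu hqv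
  · simp only [map_add, map_sub, star_add, star_sub, add_mul, mul_add, sub_mul, mul_sub,
      Complex.add_re, Complex.sub_re]
    ring
  · have : r • u = (r : ℂ) • u := (Complex.coe_smul r u).symm
    rw [this, map_smul, star_smul, smul_mul_smul_comm, map_smul, Complex.star_def,
      Complex.conj_ofReal, ← Complex.ofReal_mul, smul_eq_mul, Complex.re_ofReal_mul, sq]
  · rintro _ ⟨g, rfl⟩
    exact hx.map_twist_mul_star_le hφ hlam hxlam g u
  · have h := hx.map_twist_mul_star_le hφ hlam hxlam g⁻¹ (twist α x g u)
    rwa [hx.twist_twist hφ.faithful, mul_inv_cancel, hx.twist_one hφ.faithful] at h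

end Twist

/-! ### Existence of the invariant state -/

section InvariantState

variable {M : VonNeumannAlgebra H} {G : Type v} [Group G]
  {α : G →* (Elem M ≃⋆ₐ[ℂ] Elem M)} {x : G → Elem M} {φ : Elem M →ₗ[ℂ] ℂ}

theorem IsCocycle.twist_mem_convexHull (hφ : IsFaithful φ) (hx : IsCocycle α φ x) (g : G)
    {y : Elem M} (hy : y ∈ convexHull ℝ (Set.range x)) :
    twist α x g y ∈ convexHull ℝ (Set.range x) := by
  refine convexHull_min (t := ((twist α x g).restrictScalars ℝ) ⁻¹' convexHull ℝ (Set.range x))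
    ?_ ((convex_convexHull ℝ _).linear_preimage _) hy
  rintro _ ⟨h, rfl⟩
  exact subset_convexHull ℝ _ ⟨h * g, (hx.twist_derivative hφ g h).symm⟩

/-- The functionals `φ (y * ·)`, for `y` in the convex hull of the cocycle, dominate `lam⁻¹ • φ`,
because `φ = (φ ∘ α g⁻¹) ∘ α g ≤ lam • (φ ∘ α g)`. -/
theorem IsCocycle.le_map_mul_of_mem_convexHull {lam : ℝ} (hφ : IsFaithfulNormalState φ)
    (hx : IsCocycle α φ x) (hlam : 0 < lam) (hxlam : ∀ g, ‖x g‖ ≤ lam) {y : Elem M}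
    (hy : y ∈ convexHull ℝ (Set.range x)) (b : Elem M) :
    (lam⁻¹ : ℂ) * φ (star b * b) ≤ φ (y * (star b * b)) := by
  let L : Elem M →ₗ[ℝ] ℂ := (φ ∘ₗ LinearMap.mulRight ℂ (star b * b)).restrictScalars ℝ
  refine convexHull_min (t := L ⁻¹' Set.Ici ((lam⁻¹ : ℂ) * φ (star b * b))) ?_
    ((convex_Ici _).linear_preimage _) hy
  rintro _ ⟨g, rfl⟩
  change (lam⁻¹ : ℂ) * φ (star b * b) ≤ φ (x g * (star b * b))
  have h1 := Complex.nonneg_iff.mp (hφ.isState.nonneg b)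
  have h2 := Complex.nonneg_iff.mp (hφ.isState.nonneg (α g b))
  have h3 := hx.re_map_apply_le hφ hlam hxlam g⁻¹ (α g b)
  have h4 : ∀ c, α g⁻¹ (α g c) = c := fun c => by
    rw [← StarAlgEquiv.mul_apply, ← map_mul, inv_mul_cancel, map_one, StarAlgEquiv.one_apply]
  rw [← map_star, ← map_mul, h4] at h3
  rw [← hx, Complex.le_def, ← Complex.ofReal_inv, Complex.re_ofReal_mul, Complex.im_ofReal_mul,
    ← h1.2, map_mul (α g), map_star (α g), ← h2.2, mul_zero]
  rw [map_mul (α g), map_star (α g)] at h3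
  exact ⟨(inv_mul_le_iff₀ hlam).mpr h3, rfl⟩

theorem IsCocycle.map_of_mem_convexHull (hφ : IsState φ) (hx : IsCocycle α φ x) {y : Elem M}
    (hy : y ∈ convexHull ℝ (Set.range x)) : φ y = 1 := by
  refine convexHull_min (t := (φ.restrictScalars ℝ) ⁻¹' {1}) ?_
    ((convex_singleton _).linear_preimage _) hy
  rintro _ ⟨g, rfl⟩
  have := hx g 1
  rw [map_one, mul_one, hφ.map_one] at this
  exact this.symm

theorem norm_le_of_mem_convexHull {ι : Type*} {x : ι → Elem M} {lam : ℝ} (hxlam : ∀ i, ‖x i‖ ≤ lam)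
    {y : Elem M} (hy : y ∈ convexHull ℝ (Set.range x)) : ‖y‖ ≤ lam := by
  refine mem_closedBall_zero_iff.mp (convexHull_min ?_ (convex_closedBall (0 : Elem M) lam) hy)
  rintro _ ⟨i, rfl⟩
  exact mem_closedBall_zero_iff.mpr (hxlam i)

/-- A bounded cocycle has a weak operator limit `d` of convex combinations for which `φ (d * ·)` is a
faithful normal invariant state. -/
theorem IsCocycle.exists_invariant {lam : ℝ} (hφ : IsFaithfulNormalState φ)
    (hx : IsCocycle α φ x) (hlam : 0 < lam) (hxlam : ∀ g, ‖x g‖ ≤ lam) :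
    ∃ d : Elem M, IsFaithfulNormalState (φ ∘ₗ LinearMap.mulLeft ℂ d) ∧
      IsInvariant α (φ ∘ₗ LinearMap.mulLeft ℂ d) := by
  set C := convexHull ℝ (Set.range x) with hCdef
  have hne : (supNormSq α x φ '' C).Nonempty :=
    ⟨_, x 1, subset_convexHull ℝ _ ⟨1, rfl⟩, rfl⟩
  have hex : ∀ n : ℕ, ∃ y ∈ C,
      supNormSq α x φ y ≤ sInf (supNormSq α x φ '' C) + 1 / ((n : ℝ) + 1) := fun n => by
    obtain ⟨_, ⟨y, hy, rfl⟩, h⟩ := Real.lt_sInf_add_pos hne (Nat.one_div_pos_of_nat (n := n))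
    exact ⟨y, hy, h.le⟩
  choose y hyC hyq using hex
  obtain ⟨d, hd⟩ := exists_tendsto_inner M (hyperfilter ℕ)
    fun n => norm_le_of_mem_convexHull hxlam (hyC n)
  have hlim : ∀ a, Tendsto (fun n => φ (y n * a)) (hyperfilter ℕ) (𝓝 (φ (d * a))) := fun a => by
    refine tendsto_of_tendsto_inner hφ.normal (lam := lam * ‖a‖) (Eventually.of_forall fun n => ?_)
      fun ξ η => hd ξ _
    exact (norm_mul_le _ _).trans
      (by gcongr; exact norm_le_of_mem_convexHull hxlam (hyC n))
  -- Domination of `lam⁻¹ • φ` survives in the limit and gives positivity and faithfulness.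
  have hge : ∀ b, (lam⁻¹ : ℂ) * φ (star b * b) ≤ φ (d * (star b * b)) := fun b =>
    ge_of_tendsto (hlim _) (Eventually.of_forall fun n =>
      hx.le_map_mul_of_mem_convexHull hφ hlam hxlam (hyC n) b)
  have hl : (0 : ℂ) < (lam⁻¹ : ℂ) := by
    rw [← Complex.ofReal_inv]
    exact Complex.zero_lt_real.mpr (inv_pos.mpr hlam)
  refine ⟨d, ⟨⟨fun b => ?_, ?_⟩, hφ.normal.comp_mulLeft d, fun b hb => ?_⟩, fun g a => ?_⟩
  · exact (mul_nonneg hl.le (hφ.isState.nonneg b)).trans (hge b)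
  · refine tendsto_nhds_unique (hlim 1) ?_
    simp [hx.map_of_mem_convexHull hφ.isState (hyC _)]
  · refine hφ.faithful b (le_antisymm ?_ (hφ.isState.nonneg b))
    have h := hge b
    have hb' : φ (d * (star b * b)) = 0 := hb
    rw [hb'] at h
    exact le_of_mul_le_mul_left (by rwa [mul_zero]) hl
  · -- `y n` and `twist g (y n)` are both almost minimizers, so `φ (y n * α g a) - φ (y n * a)` tends
    -- to zero.
    change φ (d * α g a) = φ (d * a)
    refine sub_eq_zero.mp (tendsto_nhds_unique ((hlim (α g a)).sub (hlim a)) ?_)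
    have hb : ∀ n, ‖φ (y n * α g a) - φ (y n * a)‖ ^ 2 ≤
        4 * lam * (1 / ((n : ℝ) + 1)) * (φ (star a * a)).re := fun n => by
      rw [← hx.map_twist_mul, ← map_sub, ← sub_mul]
      refine (norm_map_mul_sq_le hφ.isState.nonneg _ _).trans ?_
      have h0 : 0 ≤ (φ (star a * a)).re := (Complex.nonneg_iff.mp (hφ.isState.nonneg a)).1
      gcongr
      refine hx.map_sub_mul_star_le hφ hlam hxlam (convex_convexHull ℝ (Set.range x))
        (hx.twist_mem_convexHull hφ.faithful g (hyC n)) (hyC n) ?_ (hyq n)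
      rw [hx.supNormSq_twist hφ.faithful]
      exact hyq n
    have hlim0 : Tendsto (fun n : ℕ => 4 * lam * (1 / ((n : ℝ) + 1)) * (φ (star a * a)).re)
        atTop (𝓝 0) := by
      simpa using (tendsto_one_div_add_atTop_nhds_zero_nat.const_mul (4 * lam)).mul_const
        (φ (star a * a)).re
    have hsq := squeeze_zero (fun n => sq_nonneg _) hb hlim0
    have hn : Tendsto (fun n => φ (y n * α g a) - φ (y n * a)) atTop (𝓝 0) := by
      refine tendsto_zero_iff_norm_tendsto_zero.mpr ?_
      simpa using hsq.sqrt
    exact hn.mono_left (Nat.hyperfilter_le_atTop)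

end InvariantState

end QuasiInvariant

open QuasiInvariant in
theorem theorem3p2 {H : Type*} [NormedAddCommGroup H] [InnerProductSpace ℂ H] [CompleteSpace H]
    (M : VonNeumannAlgebra H) {G : Type*} [Group G]
    (α : G →* (Elem M ≃⋆ₐ[ℂ] Elem M)) (hα : ∀ g, IsNormalAut (α g)) :
    (∀ (φ : Elem M →ₗ[ℂ] ℂ) (x : G → Elem M),
      IsQuasiInvariant α φ → IsCocycle α φ x → IsUniformlyBounded x →
        ∃ (ψ : Elem M →ₗ[ℂ] ℂ) (d : Elem M),
          IsFaithfulNormalState ψ ∧ IsInvariant α ψ ∧ ∀ a, ψ a = φ (d * a)) ∧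
    (∀ (φ ψ : Elem M →ₗ[ℂ] ℂ) (d : (Elem M)ˣ),
      IsState φ → IsFaithfulNormalState ψ → IsInvariant α ψ → (∀ a, ψ a = φ (d * a)) →
        IsQuasiInvariant α φ ∧
        IsCocycle α φ (fun g => (d : Elem M) * α g⁻¹ ((d⁻¹ : (Elem M)ˣ) : Elem M)) ∧
        IsUniformlyBounded (fun g => (d : Elem M) * α g⁻¹ ((d⁻¹ : (Elem M)ˣ) : Elem M))) := by
  refine ⟨fun φ x hφ hx ⟨lam, hlam, hxlam⟩ => ?_, fun φ ψ d hφ hψ hinv hd => ?_⟩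
  · obtain ⟨d, hd, hinv⟩ := hx.exists_invariant hφ.isFaithfulNormalState hlam hxlam
    exact ⟨_, d, hd, hinv, fun a => rfl⟩
  · have hφψ : ∀ a, φ a = ψ (((d⁻¹ : (Elem M)ˣ) : Elem M) * a) := fun a => by
      rw [hd, Units.mul_inv_cancel_left]
    have hcoc : IsCocycle α φ
        (fun g => (d : Elem M) * α g⁻¹ ((d⁻¹ : (Elem M)ˣ) : Elem M)) := fun g a => by
      rw [mul_assoc, ← hd, ← hinv g, map_mul, ← StarAlgEquiv.mul_apply, ← map_mul, mul_inv_cancel,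
        map_one, StarAlgEquiv.one_apply, hφψ]
    refine ⟨⟨⟨hφ, ?_, fun a ha => hψ.faithful a ?_⟩, fun g => ⟨_, hcoc g⟩⟩, hcoc,
      ‖(d : Elem M)‖ * ‖((d⁻¹ : (Elem M)ˣ) : Elem M)‖ + 1, by positivity, fun g => ?_⟩
    · have : φ = ψ ∘ₗ LinearMap.mulLeft ℂ ((d⁻¹ : (Elem M)ˣ) : Elem M) := LinearMap.ext hφψ
      rw [this]
      exact hψ.normal.comp_mulLeft _
    · rw [hd, ← mul_assoc]
      exact map_mul_eq_zero_of_map_star_mul_self hφ.nonneg ha _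
    · refine (norm_mul_le _ _).trans ?_
      rw [norm_starAlgEquiv_apply]
      linarith
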